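/- Let $G$ be a group and let $N$ be a normal subgroup of $G$ that is solvable of derived length $d$ (the least $n\ge 0$ such that the $n$-th term $N^{(n)}$ of the derived series is trivial). Write ${}^{x}y=xyx^{-1}$ and $[x,y]=xyx^{-1}y^{-1}$. Let $N\otimes G$ be the nonabelian tensor product of $N$ and $G$, where $N$ and $G$ act on each other by conjugation: the group generated by symbols $n\otimes g$ ($n\in N$, $g\in G$) subject to the relations $$nn'\otimes g=({}^{n}n'\otimes{}^{n}g)(n\otimes g),\qquad n\otimes gg'=(n\otimes g)({}^{g}n\otimes{}^{g}g')$$ for all $n,n'\in N$ and $g,g'\in G$. Let $N\wedge G$ be the quotient of $N\otimes G$ by the normal subgroup generated by the elements $n\otimes n$, $n\in N$, and let the relative Schur multiplier $M(G,N)$ of the pair $(G,N)$ be the kernel of the homomorphism $N\wedge G\to G$ induced by $n\otimes g\mapsto[n,g]$. For a group $X$ let $\exp(X)$ be its exponent, the least positive integer $e$ with $x^e=1$ for all $x\in X$, with $\exp(X)=0$ if there is no such $e$. (i) If $\exp(N)$ is odd, then $\exp(N\otimes G)$ divides $\exp(N)^d$. In particular, $\exp(M(G,N))$ divides $\exp(N)^d$.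 (ii) If $\exp(N)$ is even, then $\exp(N\otimes G)$ divides $2^d\exp(N)^d$. In particular, $\exp(M(G,N))$ divides $2^d\exp(N)^d$. -/

import Mathlib

/-- The derived length of a solvable group: the least `n` with `derivedSeries H n = ⊥`
(only meaningful for solvable groups). -/
noncomputable def derivedLength (H : Type*) [Group H] : ℕ :=
  sInf {n : ℕ | derivedSeries H n = ⊥}

namespace NonabelianTensor

section

variable {G : Type*} [Group G] (N : Subgroup G) [N.Normal]

/-- The left conjugate `ᵍn = g n g⁻¹` of an element of a normal subgroup. -/
def conjN (g : G) (n : N) : N :=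
  ⟨g * (n : G) * g⁻¹, Subgroup.Normal.conj_mem ‹N.Normal› (n : G) n.2 g⟩

/-- The defining relators of the nonabelian tensor product `N ⊗ G` of a normal subgroup `N` of `G`
with `G`, where `N` and `G` act on each other by left conjugation:
`n n' ⊗ g = (ⁿn' ⊗ ⁿg)(n ⊗ g)` and `n ⊗ g g' = (n ⊗ g)(ᵍn ⊗ ᵍg')`. -/
inductive TensorRel : FreeGroup (N × G) → Prop
  | mul_left (n n' : N) (g : G) : TensorRel
      (FreeGroup.of (n * n', g) *
        (FreeGroup.of (conjN N (n : G) n', (n : G) * g * (n : G)⁻¹) * FreeGroup.of (n, g))⁻¹)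
  | mul_right (n : N) (g g' : G) : TensorRel
      (FreeGroup.of (n, g * g') *
        (FreeGroup.of (n, g) * FreeGroup.of (conjN N g n, g * g' * g⁻¹))⁻¹)

/-- The nonabelian tensor product `N ⊗ G`. -/
abbrev Tensor : Type _ := PresentedGroup {r : FreeGroup (N × G) | TensorRel N r}

/-- The generator `n ⊗ g` of `N ⊗ G`. -/
def tmul (n : N) (g : G) : Tensor N := PresentedGroup.of (n, g)

/-- The commutator homomorphism `N ⊗ G → G`, `n ⊗ g ↦ [n, g] = n g n⁻¹ g⁻¹`. -/
def tensorCommutator : Tensor N →* G :=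
  PresentedGroup.toGroup (f := fun x : N × G => (x.1 : G) * x.2 * (x.1 : G)⁻¹ * x.2⁻¹) (by
    intro r hr
    cases hr with
    | mul_left n n' g =>
      simp only [map_mul, map_inv, FreeGroup.lift_apply_of, conjN,
        Subgroup.coe_mul]
      group
    | mul_right n g g' =>
      simp only [map_mul, map_inv, FreeGroup.lift_apply_of, conjN]
      group)

/-- The (normal) subgroup of `N ⊗ G` generated by the elements `n ⊗ n` with `n ∈ N`. -/
def nabla : Subgroup (Tensor N) :=
  Subgroup.normalClosure (Set.range fun n : N => tmul N n (n : G))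

instance nabla_normal : (nabla N).Normal := Subgroup.normalClosure_normal

/-- The nonabelian exterior product `N ∧ G = (N ⊗ G) / ⟨n ⊗ n : n ∈ N⟩`. -/
abbrev Exterior : Type _ := Tensor N ⧸ nabla N

theorem nabla_le_ker : nabla N ≤ (tensorCommutator N).ker := by
  refine Subgroup.normalClosure_le_normal ?_
  rintro _ ⟨n, rfl⟩
  simp [tmul, tensorCommutator, MonoidHom.mem_ker]

/-- The induced commutator homomorphism `N ∧ G → G`, `n ∧ g ↦ [n, g]`. -/
def exteriorCommutator : Exterior N →* G :=
  QuotientGroup.lift (nabla N) (tensorCommutator N) (nabla_le_ker N)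

/-- The relative Schur multiplier `M(G, N)` of the pair `(G, N)`: the kernel of the commutator
homomorphism `N ∧ G → G`. -/
def relativeMultiplier : Subgroup (Exterior N) := (exteriorCommutator N).ker

end

end NonabelianTensor

/-! ### Powers in groups of class at most two -/

section ClassTwo

variable {Q : Type*} [Group Q]

/-! Filter `N ⊗ G` by the normal subgroups `layer N M`, with `M` running through the derived series
of `N`. It suffices that `c`-th powers send each layer into the next (`pow_mem_layer`), whenever
`exp N` divides `c` and `c.choose 2`. Modulo the next layer the pairing is bilinear on `M × M`, and
its values there are central in the layer and killed by `exp N`. They contain the commutators of the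
generators, so the layer has class at most two. They also contain the correction `z` in `n ^ k ⊗ g =
z ^ (-k.choose 2) * (n ⊗ g) ^ k`, so taking `k = c` kills the generators, and the class-two power
formula does the rest. -/

theorem exists_mul_eq_of_mem_closure {T : Set Q} (Z : Subgroup Q)
    (hZ : ∀ z ∈ Z, ∀ t ∈ T, Commute z t) {s : Q} (h : ∀ t ∈ T, ∃ z ∈ Z, s * t = z * (t * s))
    {y : Q} (hy : y ∈ Subgroup.closure T) :
    (∀ z ∈ Z, Commute z y) ∧ ∃ z ∈ Z, s * y = z * (y * s) := by
  induction hy using Subgroup.closure_induction with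
  | mem t ht => exact ⟨fun z hz => hZ z hz t ht, h t ht⟩
  | one => exact ⟨fun z _ => Commute.one_right z, 1, one_mem Z, by simp⟩
  | mul a b _ _ iha ihb =>
    obtain ⟨ca, z, hz, ha⟩ := iha
    obtain ⟨cb, w, hw, hb⟩ := ihb
    refine ⟨fun z hz => (ca z hz).mul_right (cb z hz), z * w, mul_mem hz hw, ?_⟩
    calc s * (a * b) = z * (a * (s * b)) := by rw [← mul_assoc, ha]; group
      _ = z * ((a * w) * (b * s)) := by rw [hb]; group
      _ = z * w * (a * b * s) := by rw [← (ca w hw).eq]; group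
  | inv a _ iha =>
    obtain ⟨ca, z, hz, ha⟩ := iha
    refine ⟨fun z hz => (ca z hz).inv_right, z⁻¹, inv_mem hz, ?_⟩
    have h2 : a * s = z⁻¹ * (s * a) := by rw [ha]; group
    calc s * a⁻¹ = a⁻¹ * (a * s) * a⁻¹ := by group
      _ = (a⁻¹ * z⁻¹) * s := by rw [h2]; group
      _ = z⁻¹ * (a⁻¹ * s) := by rw [← ((ca z hz).inv_right.inv_left).eq]; group

/-- Moving `x` past `y ^ k` costs `z ^ k`; these costs add up to `k.choose 2`. -/
theorem mul_pow_of_mul_eq {x y z : Q} (hzx : Commute z x) (hzy : Commute z y)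
    (h : x * y = z * (y * x)) (k : ℕ) : (y * x) ^ k = z ^ k.choose 2 * (y ^ k * x ^ k) := by
  have h1 : ∀ k : ℕ, x * y ^ k = z ^ k * (y ^ k * x) := by
    intro k
    induction k with
    | zero => simp
    | succ k ih =>
      calc x * y ^ (k + 1) = (x * y ^ k) * y := by rw [pow_succ]; group
        _ = z ^ k * (y ^ k * (x * y)) := by rw [ih]; group
        _ = z ^ k * ((y ^ k * z) * (y * x)) := by rw [h]; group
        _ = z ^ (k + 1) * (y ^ (k + 1) * x) := by
          rw [← (hzy.pow_right k).eq, pow_succ z, pow_succ y]; group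
  induction k with
  | zero => simp
  | succ k ih =>
    have hc := ((hzy.mul_right hzx).pow_left (k.choose 2)).eq
    have hk := (hzy.pow_left k).eq
    calc (y * x) ^ (k + 1) = ((y * x) * z ^ k.choose 2) * (y ^ k * x ^ k) := by
          rw [pow_succ', ih]; group
      _ = z ^ k.choose 2 * (y * (x * y ^ k) * x ^ k) := by rw [← hc]; group
      _ = z ^ k.choose 2 * ((y * z ^ k) * (y ^ k * (x * x ^ k))) := by rw [h1]; group
      _ = z ^ (k.choose 2 + k) * (y ^ (k + 1) * x ^ (k + 1)) := by
          rw [← hk, pow_add, pow_succ' x, pow_succ' y]; group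
      _ = z ^ (k + 1).choose 2 * (y ^ (k + 1) * x ^ (k + 1)) := by
          rw [Nat.choose_succ_succ' k 1, Nat.choose_one_right, Nat.add_comm k (k.choose _)]

/-- If the elements of `S` commute modulo a subgroup `Z` of exponent dividing `e` that centralizes
`S`, and have `c`-th power `1` where `e ∣ c.choose 2`, then the closure of `S` has exponent
dividing `c`. -/
theorem pow_eq_one_of_mem_closure {S : Set Q} (Z : Subgroup Q) {e c : ℕ}
    (hec : e ∣ c.choose 2) (hZe : ∀ z ∈ Z, z ^ e = 1) (hZ : ∀ z ∈ Z, ∀ s ∈ S, Commute z s)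
    (hS : ∀ s ∈ S, s ^ c = 1) (hcomm : ∀ s ∈ S, ∀ t ∈ S, ∃ z ∈ Z, s * t = z * (t * s))
    {x : Q} (hx : x ∈ Subgroup.closure S) : x ^ c = 1 := by
  have key : ∀ a ∈ Subgroup.closure S, ∀ b ∈ Subgroup.closure S,
      ∃ z ∈ Z, a * b = z * (b * a) := by
    intro a ha b hb
    refine (exists_mul_eq_of_mem_closure Z hZ (fun t ht => ?_) hb).2
    obtain ⟨hz, z, hzZ, h⟩ := exists_mul_eq_of_mem_closure Z hZ (hcomm t ht) ha
    exact ⟨z⁻¹, inv_mem hzZ, by rw [h]; group⟩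
  -- Only the centralizing half is needed, so `s = 1` makes the other half trivial.
  have hcl : ∀ z ∈ Z, ∀ a ∈ Subgroup.closure S, Commute z a := fun z hz a ha =>
    (exists_mul_eq_of_mem_closure (s := 1) Z hZ (fun t _ => ⟨1, one_mem Z, by simp⟩) ha).1 z hz
  induction hx using Subgroup.closure_induction with
  | mem t ht => exact hS t ht
  | one => exact one_pow c
  | mul a b ha hb iha ihb =>
    obtain ⟨z, hz, h⟩ := key b hb a ha
    obtain ⟨q, hq⟩ := hec
    rw [mul_pow_of_mul_eq (hcl z hz b hb) (hcl z hz a ha) h, iha, ihb, hq, pow_mul, hZe z hz]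
    simp
  | inv a _ iha => rw [inv_pow, iha, inv_one]

end ClassTwo

/-! ### Identities for crossed pairings -/

namespace NonabelianTensor

variable {G : Type*} [Group G] {N : Subgroup G} [N.Normal] {Q : Type*} [Group Q]

@[simp]
theorem conjN_mul (g h : G) (n : N) : conjN N (g * h) n = conjN N g (conjN N h n) := by
  ext; simp only [conjN]; group

/-- A map `N × G → Q` satisfying the defining relations of `N ⊗ G`. -/
structure IsCrossedPairing (f : N → G → Q) : Prop where
  mul_left (n n' : N) (g : G) :
    f (n * n') g = f (conjN N (n : G) n') ((n : G) * g * (n : G)⁻¹) * f n g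
  mul_right (n : N) (g g' : G) : f n (g * g') = f n g * f (conjN N g n) (g * g' * g⁻¹)

theorem isCrossedPairing_tmul (φ : Tensor N →* Q) :
    IsCrossedPairing fun (n : N) g => φ (tmul N n g) where
  mul_left n n' g := by
    rw [← map_mul]
    congr 1
    exact mul_inv_eq_one.1 (PresentedGroup.one_of_mem (TensorRel.mul_left n n' g))
  mul_right n g g' := by
    rw [← map_mul]
    congr 1
    exact mul_inv_eq_one.1 (PresentedGroup.one_of_mem (TensorRel.mul_right n g g'))

namespace IsCrossedPairing

variable {f : N → G → Q}

theorem one_left (hf : IsCrossedPairing f) (g : G) : f 1 g = 1 := by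
  have h := hf.mul_left 1 1 g
  have h1 : conjN N ((1 : N) : G) 1 = 1 := by ext; simp [conjN]
  rw [h1] at h
  simpa using h

theorem one_right (hf : IsCrossedPairing f) (n : N) : f n 1 = 1 := by
  have h := hf.mul_right n 1 1
  have h1 : conjN N (1 : G) n = n := by ext; simp [conjN]
  rw [h1] at h
  simpa using h

/-- Expand `f (n * n') (g * g')` starting from either variable and cancel the common outer factors.
-/
theorem conj_mul_eq (hf : IsCrossedPairing f) (n n' : N) (g g' : G) :
    f (conjN N (n * g) n') (n * g * g' * (n * g)⁻¹) * f n g =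
      f n g * f (conjN N (g * n) n') (g * n * g' * (g * n)⁻¹) := by
  have h1 : f (n * n') (g * g') = f (conjN N n n') (n * g * (n : G)⁻¹) *
      f (conjN N (n * g) n') (n * g * g' * (n * g)⁻¹) * (f n g * f (conjN N g n) (g * g' * g⁻¹)) := by
    rw [hf.mul_left n n' (g * g'), hf.mul_right n g g',
      show (n : G) * (g * g') * (n : G)⁻¹ = (n * g * (n : G)⁻¹) * (n * g' * (n : G)⁻¹) by group,
      hf.mul_right (conjN N n n')]
    congr 3
    · ext; simp only [conjN]; group
    · group
  have h2 : f (n * n') (g * g') = f (conjN N n n') (n * g * (n : G)⁻¹) * f n g *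
      (f (conjN N (g * n) n') (g * n * g' * (g * n)⁻¹) * f (conjN N g n) (g * g' * g⁻¹)) := by
    rw [hf.mul_right (n * n') g g', hf.mul_left n n' g,
      show conjN N g (n * n') = conjN N g n * conjN N g n' by
        ext; simp only [conjN, Subgroup.coe_mul]; group,
      hf.mul_left (conjN N g n)]
    congr 3
    · ext; simp only [conjN]; group
    · simp only [conjN]; group
  refine mul_left_cancel (a := f (conjN N n n') (n * g * (n : G)⁻¹))
    (mul_right_cancel (b := f (conjN N g n) (g * g' * g⁻¹)) ?_)
  rw [h1] at h2
  convert h2 using 1 <;> simp only [← mul_assoc]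

/-- `f n g` acts on the values of `f` by conjugation as the commutator `[n, g]`. -/
theorem conj_eq (hf : IsCrossedPairing f) (n n' : N) (g g' : G) :
    f n g * f n' g' * (f n g)⁻¹ =
      f (conjN N (n * g * (n : G)⁻¹ * g⁻¹) n')
        (n * g * (n : G)⁻¹ * g⁻¹ * g' * (n * g * (n : G)⁻¹ * g⁻¹)⁻¹) := by
  have h := hf.conj_mul_eq n (conjN N (g * n)⁻¹ n') g ((g * n)⁻¹ * g' * (g * n))
  rw [mul_inv_eq_iff_eq_mul]
  convert h.symm using 3
  · ext; simp only [conjN]; group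
  · group
  · ext; simp only [conjN]; group
  · group

theorem commutator_left (hf : IsCrossedPairing f) (n : N) (g h : G) :
    f (n * conjN N g n⁻¹) h = f n g * (f (conjN N h n) (h * g * h⁻¹))⁻¹ := by
  have h1 := hf.mul_left n (conjN N g n⁻¹) h
  have h2 := hf.conj_mul_eq n n⁻¹ g (g⁻¹ * h * g)
  have h3 := hf.mul_left (conjN N g n) (conjN N g n)⁻¹ h
  have h4 : f n g * f (conjN N g n) h = f n h * f (conjN N h n) (h * g * h⁻¹) := by
    rw [← hf.mul_right n h g, show h * g = g * (g⁻¹ * h * g) by group, hf.mul_right n g,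
      show g * (g⁻¹ * h * g) * g⁻¹ = h by group]
  rw [mul_inv_cancel, hf.one_left] at h3
  have e1 : conjN N (conjN N g n : N) (conjN N g n)⁻¹ = conjN N (g * n) n⁻¹ := by
    ext; simp only [conjN, Subgroup.coe_inv]; group
  have e2 : ((conjN N g n : N) : G) * h * ((conjN N g n : N) : G)⁻¹ =
      g * n * (g⁻¹ * h * g) * (g * n)⁻¹ := by
    simp only [conjN]; group
  rw [e1, e2] at h3
  rw [eq_inv_of_mul_eq_one_left h3.symm, ← eq_mul_inv_iff_mul_eq] at h2
  rw [show n * g * (g⁻¹ * h * g) * (n * g)⁻¹ = n * h * (n : G)⁻¹ by group, conjN_mul] at h2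
  rw [h1, h2, mul_assoc (f n g), ← mul_inv_rev, h4, mul_inv_rev]
  group

/-- The failure of `h` to fix `f n g` is itself a value of `f`, at `([n, g], h)`. Both the power
formulas and the class-two relation rest on this. -/
theorem conj_eq_inv_mul (hf : IsCrossedPairing f) (n : N) (g h : G) :
    f (conjN N h n) (h * g * h⁻¹) = (f (n * conjN N g n⁻¹) h)⁻¹ * f n g := by
  rw [hf.commutator_left]; group

/-! ### One layer, modulo `L ≥ [M, M]` -/

section Layer

variable {M L : Subgroup G} [hL : L.Normal]

theorem commutator_mem [hM : M.Normal] {u : G} {x : G} (h : u ∈ M ∨ x ∈ M) : u * x * u⁻¹ * x⁻¹ ∈ M := by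
  rcases h with h | h
  · rw [mul_assoc, mul_assoc, ← mul_assoc x]
    exact mul_mem h (hM.conj_mem _ (inv_mem h) x)
  · exact mul_mem (hM.conj_mem _ h u) (inv_mem h)

theorem eq_of_mem (hf : IsCrossedPairing f)
    (hfL : ∀ (n : N) (g : G), (n : G) ∈ L ∨ g ∈ L → f n g = 1) {n n' : N} {g g' : G}
    (hn : (n : G)⁻¹ * n' ∈ L) (hg : g⁻¹ * g' ∈ L) : f n' g' = f n g := by
  have h1 : f n' g' = f n g' := by
    have := hf.mul_left n (n⁻¹ * n') g'
    rw [mul_inv_cancel_left] at this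
    rw [this, hfL (conjN N n _) _ (Or.inl (hL.conj_mem _ hn _)), one_mul]
  have := hf.mul_right n g (g⁻¹ * g')
  rw [hfL _ (g * (g⁻¹ * g') * g⁻¹) (Or.inr (hL.conj_mem _ hg _)), mul_one,
    mul_inv_cancel_left] at this
  rw [h1, this]

/-- Conjugation by `u` changes elements of `M` only by commutators in `[M, M] ≤ L`, which `f` does
not see. -/
theorem conj_eq_self (hf : IsCrossedPairing f) (hML : ⁅M, M⁆ ≤ L)
    (hfL : ∀ (n : N) (g : G), (n : G) ∈ L ∨ g ∈ L → f n g = 1) {u : G} {n : N} {g : G}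
    (hu : u ∈ M) (hn : (n : G) ∈ M) (hg : g ∈ M) :
    f (conjN N u n) (u * g * u⁻¹) = f n g := by
  have key : ∀ x ∈ M, x⁻¹ * (u * x * u⁻¹) ∈ L := fun x hx => by
    have := hML (Subgroup.commutator_mem_commutator (inv_mem hx) hu)
    rw [commutatorElement_def, inv_inv] at this
    convert this using 1
    group
  exact hf.eq_of_mem hfL (key n hn) (key g hg)

theorem mul_left_of_mem (hf : IsCrossedPairing f) (hML : ⁅M, M⁆ ≤ L)
    (hfL : ∀ (n : N) (g : G), (n : G) ∈ L ∨ g ∈ L → f n g = 1) {n n' : N} {g : G}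
    (hn : (n : G) ∈ M) (hn' : (n' : G) ∈ M) (hg : g ∈ M) : f (n * n') g = f n' g * f n g := by
  rw [hf.mul_left, hf.conj_eq_self hML hfL hn hn' hg]

theorem mul_right_of_mem (hf : IsCrossedPairing f) (hML : ⁅M, M⁆ ≤ L)
    (hfL : ∀ (n : N) (g : G), (n : G) ∈ L ∨ g ∈ L → f n g = 1) {n : N} {g g' : G}
    (hn : (n : G) ∈ M) (hg : g ∈ M) (hg' : g' ∈ M) : f n (g * g') = f n g * f n g' := by
  rw [hf.mul_right, hf.conj_eq_self hML hfL hg hn hg']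

theorem pow_left_of_mem (hf : IsCrossedPairing f) (hML : ⁅M, M⁆ ≤ L)
    (hfL : ∀ (n : N) (g : G), (n : G) ∈ L ∨ g ∈ L → f n g = 1) {n : N} {g : G}
    (hn : (n : G) ∈ M) (hg : g ∈ M) (k : ℕ) : f (n ^ k) g = f n g ^ k := by
  induction k with
  | zero => simp [hf.one_left]
  | succ k ih =>
    rw [pow_succ, pow_succ', hf.mul_left_of_mem hML hfL (by simpa using pow_mem hn k) hn hg, ih]

theorem pow_right_of_mem (hf : IsCrossedPairing f) (hML : ⁅M, M⁆ ≤ L)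
    (hfL : ∀ (n : N) (g : G), (n : G) ∈ L ∨ g ∈ L → f n g = 1) {n : N} {g : G}
    (hn : (n : G) ∈ M) (hg : g ∈ M) (k : ℕ) : f n (g ^ k) = f n g ^ k := by
  induction k with
  | zero => simp [hf.one_right]
  | succ k ih =>
    rw [pow_succ, pow_succ, hf.mul_right_of_mem hML hfL hn (pow_mem hg k) hg, ih]

/-- `f n h` acts on values as `[n, h]`, which lies in `M` and so fixes `f m g`. -/
theorem commute_of_mem [hM : M.Normal] (hf : IsCrossedPairing f) (hML : ⁅M, M⁆ ≤ L)
    (hfL : ∀ (n : N) (g : G), (n : G) ∈ L ∨ g ∈ L → f n g = 1) {m n : N} {g h : G}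
    (hm : (m : G) ∈ M) (hg : g ∈ M) (hnh : (n : G) ∈ M ∨ h ∈ M) : Commute (f m g) (f n h) := by
  have := hf.conj_eq n m h g
  rw [hf.conj_eq_self hML hfL (commutator_mem hnh) hm hg, mul_inv_eq_iff_eq_mul] at this
  exact this.symm

theorem conj_pow_eq [hM : M.Normal] (hf : IsCrossedPairing f) (hML : ⁅M, M⁆ ≤ L)
    (hfL : ∀ (n : N) (g : G), (n : G) ∈ L ∨ g ∈ L → f n g = 1) {n : N} {g h : G}
    (hng : (n : G) ∈ M ∨ g ∈ M) (hh : h ∈ M) (k : ℕ) :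
    f (conjN N (h ^ k) n) (h ^ k * g * (h ^ k)⁻¹) = (f (n * conjN N g n⁻¹) h ^ k)⁻¹ * f n g := by
  rw [hf.conj_eq_inv_mul, hf.pow_right_of_mem hML hfL _ hh]
  convert commutator_mem hng using 1
  simp only [conjN, Subgroup.coe_mul, Subgroup.coe_inv]; group

/-- Peeling off one factor `n` conjugates `f n g` by `n ^ k`, which costs `z ^ k` with `z = f [n, g]
n`; the costs sum to `k.choose 2`. -/
theorem pow_left [hM : M.Normal] (hf : IsCrossedPairing f) (hML : ⁅M, M⁆ ≤ L)
    (hfL : ∀ (n : N) (g : G), (n : G) ∈ L ∨ g ∈ L → f n g = 1) {n : N} {g : G}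
    (hn : (n : G) ∈ M) (k : ℕ) :
    f (n ^ k) g = (f (n * conjN N g n⁻¹) n ^ k.choose 2)⁻¹ * f n g ^ k := by
  set z := f (n * conjN N g n⁻¹) n with hz
  have hc : Commute z (f n g) := hf.commute_of_mem hML hfL (by
    convert commutator_mem (x := g) (Or.inl hn) using 1
    simp only [conjN, Subgroup.coe_mul, Subgroup.coe_inv]; group) hn (Or.inl hn)
  induction k with
  | zero => simp [hf.one_left]
  | succ k ih =>
    have h1 := hf.mul_left (n ^ k) n g
    rw [Subgroup.coe_pow, hf.conj_pow_eq hML hfL (Or.inl hn) hn, ← hz, ih] at h1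
    have hc' := ((hc.pow_left (k.choose 2)).inv_left).eq
    rw [pow_succ, h1, Nat.choose_succ_succ' k 1, Nat.choose_one_right, pow_add, mul_inv_rev,
      pow_succ', mul_assoc, ← mul_assoc (f n g), ← hc',
      ((Commute.refl z).pow_pow k (k.choose 2)).inv_inv.symm.eq]
    group

theorem pow_right [hM : M.Normal] (hf : IsCrossedPairing f) (hML : ⁅M, M⁆ ≤ L)
    (hfL : ∀ (n : N) (g : G), (n : G) ∈ L ∨ g ∈ L → f n g = 1) {n : N} {g : G}
    (hg : g ∈ M) (k : ℕ) :
    f n (g ^ k) = (f (n * conjN N g n⁻¹) g ^ k.choose 2)⁻¹ * f n g ^ k := by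
  set z := f (n * conjN N g n⁻¹) g with hz
  have hc : Commute z (f n g) := hf.commute_of_mem hML hfL (by
    convert commutator_mem (u := (n : G)) (Or.inr hg) using 1
    simp only [conjN, Subgroup.coe_mul, Subgroup.coe_inv]; group) hg (Or.inr hg)
  induction k with
  | zero => simp [hf.one_right]
  | succ k ih =>
    have h1 := hf.mul_right n (g ^ k) g
    rw [hf.conj_pow_eq hML hfL (Or.inr hg) hg, ← hz, ih] at h1
    have hc' := (((hc.pow_left k).inv_left).pow_right k).eq
    rw [pow_succ, h1, Nat.choose_succ_succ' k 1, Nat.choose_one_right, pow_add, mul_inv_rev,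
      mul_assoc, ← mul_assoc (f n g ^ k), ← hc', pow_succ]
    group

/-- Modulo a normal subgroup `L ≥ [M, M]`, the subgroup generated by the `m ⊗ g` and `n ⊗ m` with
`m ∈ M` has exponent dividing `c`. -/
theorem pow_eq_one_of_mem [hM : M.Normal] (hf : IsCrossedPairing f) (hML : ⁅M, M⁆ ≤ L) (hMN : M ≤ N)
    (hfL : ∀ (n : N) (g : G), (n : G) ∈ L ∨ g ∈ L → f n g = 1) {e c : ℕ}
    (hN : ∀ n : N, n ^ e = 1) (hec : e ∣ c) (hec' : e ∣ c.choose 2) {x : Q}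
    (hx : x ∈ Subgroup.closure {x | ∃ (n : N) (g : G), ((n : G) ∈ M ∨ g ∈ M) ∧ f n g = x}) :
    x ^ c = 1 := by
  have hNc : ∀ n : N, n ^ c = 1 := by
    obtain ⟨q, rfl⟩ := hec
    intro n
    rw [pow_mul, hN, one_pow]
  have hCe : ∀ (n : N) (g : G), (n : G) ∈ M → g ∈ M → f n g ^ e = 1 := fun n g hn hg => by
    rw [← hf.pow_left_of_mem hML hfL hn hg, hN, hf.one_left]
  have hcomm : ∀ (n : N) (g : G), (n : G) ∈ M ∨ g ∈ M → ((n * conjN N g n⁻¹ : N) : G) ∈ M := by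
    intro n g h
    convert commutator_mem h using 1
    simp only [conjN, Subgroup.coe_mul, Subgroup.coe_inv]; group
  have hCc : ∀ (n : N) (g : G), (n : G) ∈ M → g ∈ M → f n g ^ c.choose 2 = 1 := fun n g hn hg => by
    obtain ⟨q, hq⟩ := hec'
    rw [hq, pow_mul, hCe n g hn hg, one_pow]
  let C : Set Q := {x | ∃ (n : N) (g : G), (n : G) ∈ M ∧ g ∈ M ∧ f n g = x}
  refine pow_eq_one_of_mem_closure (Subgroup.closure C) hec' ?_ ?_ ?_ ?_ hx
  · intro z hz
    -- The elements of `C` commute with each other, so the trivial subgroup serves as `Z`.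
    refine pow_eq_one_of_mem_closure (S := C) ⊥ (e := 1) (one_dvd _) ?_ ?_ ?_ ?_ hz
    · simp
    · intro z hz s _
      rw [Subgroup.mem_bot.1 hz]
      exact Commute.one_left s
    · rintro _ ⟨n, g, hn, hg, rfl⟩
      exact hCe n g hn hg
    · rintro _ ⟨n, g, hn, hg, rfl⟩ _ ⟨n', g', hn', hg', rfl⟩
      exact ⟨1, one_mem _, by rw [one_mul, (hf.commute_of_mem hML hfL hn hg (Or.inl hn')).eq]⟩
  · rintro z hz _ ⟨n, g, h, rfl⟩
    induction hz using Subgroup.closure_induction with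
    | mem z hz =>
      obtain ⟨n', g', hn', hg', rfl⟩ := hz
      exact hf.commute_of_mem hML hfL hn' hg' h
    | one => exact Commute.one_left _
    | mul a b _ _ ha hb => exact ha.mul_left hb
    | inv a _ ha => exact ha.inv_left
  · rintro _ ⟨n, g, h, rfl⟩
    rcases h with h | h
    · have := hf.pow_left hML hfL (g := g) h c
      rw [hNc, hf.one_left, hCc _ _ (hcomm n g (Or.inl h)) h] at this
      simpa using this.symm
    · have := hf.pow_right hML hfL (n := n) h c
      have hgc : g ^ c = 1 := by simpa using congrArg Subtype.val (hNc ⟨g, hMN h⟩)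
      rw [hgc, hf.one_right, hCc _ _ (hcomm n g (Or.inr h)) h] at this
      simpa using this.symm
  · rintro _ ⟨n, g, h, rfl⟩ _ ⟨n', g', h', rfl⟩
    -- The witness is the inverse of `f [n', g'] [n, g]`, whose two arguments both lie in `M`.
    refine ⟨_, inv_mem (Subgroup.subset_closure ⟨_, _, hcomm n' g' h', commutator_mem h, rfl⟩), ?_⟩
    rw [← mul_assoc, ← hf.conj_eq_inv_mul, ← hf.conj_eq]
    group

end Layer

end IsCrossedPairing

/-! ### The filtration of `N ⊗ G` by layers -/

/-- The subgroup of `N ⊗ G` generated by the `m ⊗ g` and `n ⊗ m` with `m ∈ M`. -/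
def layer (N : Subgroup G) [N.Normal] (M : Subgroup G) : Subgroup (Tensor N) :=
  Subgroup.closure {x | ∃ (n : N) (g : G), ((n : G) ∈ M ∨ g ∈ M) ∧ tmul N n g = x}

theorem closure_range_tmul :
    Subgroup.closure (Set.range fun x : N × G => tmul N x.1 x.2) = ⊤ :=
  PresentedGroup.closure_range_of _

/-- Inner automorphisms of `N ⊗ G` come from conjugation in `G`, which is why layers of normal
subgroups are normal. -/
theorem exists_conj_tmul (t : Tensor N) : ∃ h : G, ∀ (n : N) (g : G),
    t * tmul N n g * t⁻¹ = tmul N (conjN N h n) (h * g * h⁻¹) := by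
  have ht : t ∈ Subgroup.closure (Set.range fun x : N × G => tmul N x.1 x.2) := by
    rw [closure_range_tmul]; trivial
  induction ht using Subgroup.closure_induction with
  | mem t ht =>
    obtain ⟨⟨n, g⟩, rfl⟩ := ht
    exact ⟨_, fun n' g' => (isCrossedPairing_tmul (MonoidHom.id (Tensor N))).conj_eq n n' g g'⟩
  | one => exact ⟨1, fun n g => by simp [conjN]⟩
  | mul a b _ _ ha hb =>
    obtain ⟨h, ha⟩ := ha
    obtain ⟨k, hb⟩ := hb
    refine ⟨h * k, fun n g => ?_⟩
    rw [conjN_mul, show h * k * g * (h * k)⁻¹ = h * (k * g * k⁻¹) * h⁻¹ by group, ← ha, ← hb]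
    group
  | inv a _ ha =>
    obtain ⟨h, ha⟩ := ha
    refine ⟨h⁻¹, fun n g => ?_⟩
    have := ha (conjN N h⁻¹ n) (h⁻¹ * g * h⁻¹⁻¹)
    rw [← conjN_mul, show h * (h⁻¹ * g * h⁻¹⁻¹) * h⁻¹ = g by group, mul_inv_cancel] at this
    have h1 : conjN N (1 : G) n = n := by ext; simp [conjN]
    rw [← h1, ← this, h1]
    group

instance layer_normal (M : Subgroup G) [hM : M.Normal] : (layer N M).Normal where
  conj_mem x hx t := by
    obtain ⟨h, ht⟩ := exists_conj_tmul t
    induction hx using Subgroup.closure_induction with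
    | mem x hx =>
      obtain ⟨n, g, hng, rfl⟩ := hx
      exact Subgroup.subset_closure ⟨conjN N h n, h * g * h⁻¹,
        hng.imp (fun H => hM.conj_mem _ H h) (fun H => hM.conj_mem _ H h), (ht n g).symm⟩
    | one => simp
    | mul a b _ _ ha hb =>
      rw [show t * (a * b) * t⁻¹ = (t * a * t⁻¹) * (t * b * t⁻¹) by group]
      exact mul_mem ha hb
    | inv a _ ha =>
      rw [show t * a⁻¹ * t⁻¹ = (t * a * t⁻¹)⁻¹ by group]
      exact inv_mem ha

theorem pow_mem_layer {M L : Subgroup G} [M.Normal] [L.Normal] (hML : ⁅M, M⁆ ≤ L) (hMN : M ≤ N)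
    {e c : ℕ} (hN : ∀ n : N, n ^ e = 1) (hec : e ∣ c) (hec' : e ∣ c.choose 2) {x : Tensor N}
    (hx : x ∈ layer N M) : x ^ c ∈ layer N L := by
  rw [← QuotientGroup.eq_one_iff, QuotientGroup.mk_pow]
  refine (isCrossedPairing_tmul (QuotientGroup.mk' (layer N L))).pow_eq_one_of_mem hML hMN
    (fun n g h => ?_) hN hec hec' ?_
  · exact (QuotientGroup.eq_one_iff _).2 (Subgroup.subset_closure ⟨n, g, h, rfl⟩)
  · have := Subgroup.mem_map_of_mem (QuotientGroup.mk' (layer N L)) hx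
    refine Subgroup.closure_mono ?_ ((MonoidHom.map_closure _ _).le this)
    rintro _ ⟨_, ⟨n, g, h, rfl⟩, rfl⟩
    exact ⟨n, g, h, rfl⟩

theorem tensor_pow_eq_one {e c d : ℕ} (hN : ∀ n : N, n ^ e = 1) (hec : e ∣ c)
    (hec' : e ∣ c.choose 2) (hd : derivedSeries N d = ⊥) (t : Tensor N) : t ^ c ^ d = 1 := by
  have key : ∀ i, t ^ c ^ i ∈ layer N ((derivedSeries N i).map N.subtype) := by
    intro i
    induction i with
    | zero =>
      have ht : t ∈ Subgroup.closure (Set.range fun x : N × G => tmul N x.1 x.2) := by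
        rw [closure_range_tmul]; trivial
      rw [pow_zero, pow_one]
      refine Subgroup.closure_mono ?_ ht
      rintro _ ⟨⟨n, g⟩, rfl⟩
      exact ⟨n, g, Or.inl ⟨n, trivial, rfl⟩, rfl⟩
    | succ i ih =>
      rw [pow_succ, pow_mul]
      refine pow_mem_layer ?_ (Subgroup.map_subtype_le _) hN hec hec' ih
      rw [derivedSeries_succ, Subgroup.map_commutator]
  have h := key d
  rw [hd, Subgroup.map_bot] at h
  -- The last layer is trivial, since `1 ⊗ g = n ⊗ 1 = 1`.
  have hf := isCrossedPairing_tmul (MonoidHom.id (Tensor N))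
  refine Subgroup.mem_bot.1 ((Subgroup.closure_le _).2 ?_ h)
  rintro _ ⟨n, g, h | h, rfl⟩
  · rw [Subgroup.mem_bot, OneMemClass.coe_eq_one] at h
    subst h
    exact hf.one_left g
  · rw [Subgroup.mem_bot] at h
    subst h
    exact hf.one_right n

theorem exponent_dvd {c d : ℕ} (hec : Monoid.exponent N ∣ c)
    (hec' : Monoid.exponent N ∣ c.choose 2) (hd : derivedSeries N d = ⊥) :
    Monoid.exponent (Tensor N) ∣ c ^ d ∧ Monoid.exponent (relativeMultiplier N) ∣ c ^ d := by
  have h := fun t => tensor_pow_eq_one Monoid.pow_exponent_eq_one hec hec' hd t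
  refine ⟨Monoid.exponent_dvd_of_forall_pow_eq_one h,
    Monoid.exponent_dvd_of_forall_pow_eq_one fun x => ?_⟩
  obtain ⟨t, ht⟩ := QuotientGroup.mk_surjective (x : Exterior N)
  ext
  rw [Subgroup.coe_pow, ← ht, ← QuotientGroup.mk_pow, h]
  rfl

end NonabelianTensor

/-! ### Choice of `c`: `exp N` if odd, `2 * exp N` if even -/

theorem mainTheorem11 {G : Type*} [Group G] (N : Subgroup G) [N.Normal] (d : ℕ)
    (hsolv : Group.IsSolvable N) (hd : derivedLength N = d) :
    (Odd (Monoid.exponent N) →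
      Monoid.exponent (NonabelianTensor.Tensor N) ∣ Monoid.exponent N ^ d ∧
      Monoid.exponent (NonabelianTensor.relativeMultiplier N) ∣ Monoid.exponent N ^ d) ∧
    (Even (Monoid.exponent N) →
      Monoid.exponent (NonabelianTensor.Tensor N) ∣ 2 ^ d * Monoid.exponent N ^ d ∧
      Monoid.exponent (NonabelianTensor.relativeMultiplier N) ∣
        2 ^ d * Monoid.exponent N ^ d) := by
  have hd' : derivedSeries N d = ⊥ := by
    rw [← hd]
    exact Nat.sInf_mem (s := {n : ℕ | derivedSeries N n = ⊥}) hsolv.solvable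
  constructor
  · rintro ⟨k, hk⟩
    refine NonabelianTensor.exponent_dvd dvd_rfl ?_ hd'
    rw [Nat.choose_two_right, hk]
    -- For `e = 2 * k + 1`, `e.choose 2 = e * k`.
    exact ⟨k, by rw [Nat.add_sub_cancel, mul_left_comm, Nat.mul_div_cancel_left _ two_pos]⟩
  · intro _
    rw [← mul_pow]
    refine NonabelianTensor.exponent_dvd (Dvd.intro_left _ rfl) ?_ hd'
    -- `(2 * e).choose 2 = e * (2 * e - 1)`; the factor 2 absorbs the division.
    rw [Nat.choose_two_right, mul_assoc, Nat.mul_div_cancel_left _ two_pos]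
    exact Dvd.intro _ rfl
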